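/- **Setting.** Fix countably infinite supplies of variables, constants and predicates. An *atom* is $p(t_1,\dots,t_k)$ with $p$ a predicate of arity $k$ and each $t_i$ a variable or a constant; a *fact* is an atom without variables. An *existential rule* $R = B \to H$ is a formula $\forall \vec x\,\forall \vec y\,(B[\vec x,\vec y] \to \exists \vec z\, H[\vec x,\vec z])$ where $B$ (body) and $H$ (head) are nonempty conjunctions of atoms, viewed as sets of atoms; the variables $\vec z$, which occur only in $H$, are called *existential*. A *knowledge base* (KB) $\mathcal K=(\mathcal F,\mathcal R)$ consists of a finite set $\mathcal F$ of facts and a finite set $\mathcal R$ of rules. An *atomic CQ* $Q$ is an existentially closed atom. *Atomic CQ entailment* over a class of KBs is the problem of deciding, given a KB $\mathcal K$ of the class and an atomic CQ $Q$, whether $\mathcal K \models Q$ in standard first-order logic. A partition $P$ of a set of terms is *admissible* if no class of $P$ contains two constants; a substitution obtained from $P$ maps every term of a class to one chosen element of that class, which is the constant of the class if there is one. A *piece-unifier* of a set of atoms $Q$ with a rule $R = B\to H$ (whose variables have been renamed so as not to occur in $Q$) is a triple $(Q',H',P)$ where $\emptyset \ne Q'\subseteq Q$, $H'\subseteq H$,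 and $P$ is an admissible partition of the terms of $Q'\cup H'$ such that (1) $\sigma(H')=\sigma(Q')$ for any substitution $\sigma$ obtained from $P$, and (2) if a class of $P$ contains an existential variable of $R$, then all other terms of the class are variables of $Q'$ that do not occur in $Q\setminus Q'$. A rule $R_2$ *depends on* a rule $R_1$ if there is a piece-unifier of the body of $R_2$ with $R_1$. A set $\mathcal R$ of rules is *aGRD* if the directed graph on $\mathcal R$ with an edge from $R_1$ to $R_2$ whenever $R_2$ depends on $R_1$ has no directed cycle (a loop counts as a cycle). A *transitivity rule* is a rule $p(x,y)\wedge p(y,z)\to p(x,z)$ with $x,y,z$ distinct variables. An *aGRD+trans* KB is a KB whose set of rules is the union of an aGRD set and a set of transitivity rules. **Theorem.** Atomic CQ entailment over aGRD+trans KBs is undecidable. It remains undecidable over the KBs whose set of rules is the union of an aGRD set and a single transitivity rule. Here undecidable means that no algorithm halts with the correct answer on every pair $(\mathcal K,Q)$ with $\mathcal K$ in the class, even if nothing is required of it on other inputs. -/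

import Mathlib

namespace ExRules

/-! ### Syntax

Variables are taken from a type `V`, constants are natural numbers.  A predicate is a pair of a name
(a natural number) and an arity; the arity of the predicate of an atom is the number of its arguments,
so that atoms with the same name and different arities have different predicates.
Finite sets of atoms, facts and rules are presented by lists. -/

/-- A term is a variable (`Sum.inl`) or a constant (`Sum.inr`). -/
abbrev Term (V : Type) : Type := V ⊕ ℕ

/-- An atom `p(t₁, …, tₖ)`: a predicate name and a list of terms. -/
abbrev Atom (V : Type) : Type := ℕ × List (Term V)

/-- A fact `p(c₁, …, cₖ)`, that is, an atom without variables. -/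
abbrev Fact : Type := ℕ × List ℕ

/-- An existential rule `B → H`, as the pair of its body `B` and its head `H`. -/
abbrev Rule (V : Type) : Type := List (Atom V) × List (Atom V)

/-- A knowledge base: a fact base and a finite set of rules. -/
abbrev KB : Type := List Fact × List (Rule ℕ)

section
variable {V W : Type}

def Rule.body (r : Rule V) : List (Atom V) := r.1

def Rule.head (r : Rule V) : List (Atom V) := r.2

def KB.facts (K : KB) : List Fact := K.1

def KB.rules (K : KB) : List (Rule ℕ) := K.2

/-- The terms that occur in a set of atoms. -/
def termsOf (A : Set (Atom V)) : Set (Term V) := {t | ∃ a ∈ A, t ∈ a.2}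

/-- The variables that occur in a set of atoms. -/
def varsOf (A : Set (Atom V)) : Set V := {x | Sum.inl x ∈ termsOf A}

def bodySet (r : Rule V) : Set (Atom V) := {a | a ∈ Rule.body r}

def headSet (r : Rule V) : Set (Atom V) := {a | a ∈ Rule.head r}

/-- The existential variables of a rule: those that occur only in its head. -/
def existVars (r : Rule V) : Set V := varsOf (headSet r) \ varsOf (bodySet r)

/-- The result of replacing every term of an atom by its image under `σ`. -/
def Atom.map (σ : Term V → Term W) (a : Atom V) : Atom W := (a.1, a.2.map σ)

/-- The renaming of the variables of a rule along `f`. -/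
def Rule.rename (f : V → W) (r : Rule V) : Rule W :=
  ((Rule.body r).map (Atom.map (Sum.map f id)), (Rule.head r).map (Atom.map (Sum.map f id)))

/-- The body and the head of a rule are nonempty conjunctions. -/
def Rule.Proper (r : Rule V) : Prop := Rule.body r ≠ [] ∧ Rule.head r ≠ []

end

/-! ### First-order semantics -/

/-- A first-order interpretation with domain `D` (nonempty, since there are constants). -/
structure Interp (D : Type) where
  const : ℕ → D
  rel : ℕ → List D → Prop

namespace Interp
variable {D V : Type}

/-- The value of a term under an assignment of the variables. -/
def eval (I : Interp D) (v : V → D) (t : Term V) : D := Sum.elim v I.const t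

def SatAtom (I : Interp D) (v : V → D) (a : Atom V) : Prop := I.rel a.1 (a.2.map (I.eval v))

def SatFact (I : Interp D) (f : Fact) : Prop := I.rel f.1 (f.2.map I.const)

/-- `∀ x y, (B → ∃ z, H)`, where `z` are the variables that do not occur in `B`. -/
def SatRule (I : Interp D) (r : Rule V) : Prop :=
  ∀ v : V → D, (∀ a ∈ Rule.body r, I.SatAtom v a) →
    ∃ w : V → D, (∀ x ∈ varsOf (bodySet r), w x = v x) ∧ ∀ a ∈ Rule.head r, I.SatAtom w a

/-- The interpretation satisfies the atomic Boolean query `q`, all of whose variables are read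
existentially. -/
def SatQuery (I : Interp D) (q : Atom V) : Prop := ∃ v : V → D, I.SatAtom v q

/-- The interpretation is a model of the knowledge base. -/
def IsModel (I : Interp D) (K : KB) : Prop :=
  (∀ f ∈ KB.facts K, I.SatFact f) ∧ ∀ r ∈ KB.rules K, I.SatRule r

end Interp

/-- Logical entailment of an atomic conjunctive query from a knowledge base. -/
def Entails (K : KB) (q : Atom ℕ) : Prop :=
  ∀ (D : Type) (I : Interp D), I.IsModel K → I.SatQuery q

/-! ### Piece-unifiers and the graph of rule dependencies -/

section
variable {V : Type}

/-- A partition is admissible if no class contains two constants. -/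
def Admissible {T : Set (Term V)} (P : Partition T) : Prop :=
  ∀ C ∈ P, ∀ c d : ℕ, Sum.inr c ∈ C → Sum.inr d ∈ C → c = d

/-- `σ` selects an element in each class of `P`, with priority given to constants. -/
def IsSubstitutionOf {T : Set (Term V)} (P : Partition T) (σ : Term V → Term V) : Prop :=
  P.IsRepFun σ ∧ ∀ C ∈ P, ∀ c : ℕ, Sum.inr c ∈ C → ∀ t ∈ C, σ t = Sum.inr c

/-- `(Q', H', P)` is a piece-unifier of the conjunctive query `Q` (a set of atoms) with the rule `r`,
whose variables are supposed not to occur in `Q`. -/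
structure IsPieceUnifier (Q : Set (Atom V)) (r : Rule V) (Q' H' : Set (Atom V))
    (P : Partition (termsOf (Q' ∪ H'))) : Prop where
  nonempty : Q'.Nonempty
  subset_query : Q' ⊆ Q
  subset_head : H' ⊆ headSet r
  admissible : Admissible P
  unifies : ∀ σ, IsSubstitutionOf P σ → Atom.map σ '' H' = Atom.map σ '' Q'
  existential : ∀ C ∈ P, ∀ z ∈ existVars r, Sum.inl z ∈ C → ∀ t ∈ C, t ≠ Sum.inl z →
    ∃ x ∈ varsOf Q', t = Sum.inl x ∧ x ∉ varsOf (Q \ Q')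

/-- The rule `r₂` depends on the rule `r₁`: there is a piece-unifier of the body of `r₂` with (the head
of) `r₁`, after the variables of the two rules have been renamed apart. -/
def DependsOn (r₂ r₁ : Rule V) : Prop :=
  ∃ (Q' H' : Set (Atom (V ⊕ V))) (P : Partition (termsOf (Q' ∪ H'))),
    IsPieceUnifier (bodySet (Rule.rename Sum.inl r₂)) (Rule.rename Sum.inr r₁) Q' H' P

/-- The edges of the graph of rule dependencies of a set of rules, from `r₁` to `r₂`. -/
def GRD (R : Set (Rule V)) (r₁ r₂ : Rule V) : Prop := r₁ ∈ R ∧ r₂ ∈ R ∧ DependsOn r₂ r₁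

/-- The graph of rule dependencies has no directed cycle (a loop is a cycle). -/
def IsAGRD (R : Set (Rule V)) : Prop := ∀ r, ¬ Relation.TransGen (GRD R) r r

/-- A rule of the form `p(x, y) ∧ p(y, z) → p(x, z)`, with three distinct variables. -/
def IsTransitivityRule (r : Rule V) : Prop :=
  ∃ (p : ℕ) (x y z : V), x ≠ y ∧ y ≠ z ∧ x ≠ z ∧
    bodySet r = {(p, [Sum.inl x, Sum.inl y]), (p, [Sum.inl y, Sum.inl z])} ∧
    headSet r = {(p, [Sum.inl x, Sum.inl z])}

end

/-- The set of rules of a knowledge base. -/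
def KB.ruleSet (K : KB) : Set (Rule ℕ) := {r | r ∈ KB.rules K}

/-- The rules of `K` form an aGRD set of rules to which transitivity rules are added. -/
def IsAGRDTrans (K : KB) : Prop :=
  (∀ r ∈ KB.rules K, Rule.Proper r) ∧
    ∃ Ra Rt : Set (Rule ℕ), IsAGRD Ra ∧ (∀ r ∈ Rt, IsTransitivityRule r) ∧
      KB.ruleSet K = Ra ∪ Rt

/-- The rules of `K` form an aGRD set of rules to which one transitivity rule is added. -/
def IsAGRDSingleTrans (K : KB) : Prop :=
  (∀ r ∈ KB.rules K, Rule.Proper r) ∧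
    ∃ (Ra : Set (Rule ℕ)) (t : Rule ℕ), IsAGRD Ra ∧ IsTransitivityRule t ∧
      KB.ruleSet K = Ra ∪ {t}

/-! ### Decidability -/

/-- The problem `P`, restricted to the instances in the class `C`, is decidable: some algorithm halts
with the right answer on every instance in `C` (nothing is asked of it on the other inputs). -/
def DecidableOn {α : Type} [Primcodable α] (C P : α → Prop) : Prop :=
  ∃ f : α →. Bool, Partrec f ∧ ∀ a, C a → ∃ b ∈ f a, (b = true ↔ P a)

end ExRules

namespace ExRules

/-! ### Substitutions and dependencies -/

/-! The halting problem reduces to entailment in two stages. Rules simulate computation: the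
existential rule `succRule` prolongs a successor chain forever, and Datalog clauses derive
arithmetic and, by recursion on a `Code`, the graph of its partial function. The natural numbers
form a model, so no false value is entailed; every model contains an image of them on which these
graphs hold (`Numerals.rel_codeName`), so every halting computation is entailed.

The cycles among these rules are then hidden behind one transitive predicate p. A rule B → H with
body terms x is split into B → ∃ z₀ z₁ z₂, trig(z₀, z₂, x) ∧ p(z₀, z₁) ∧ p(z₁, z₂) and trig(z₀, z₂,
x) ∧ p(z₀, z₂) → H. Transitivity supplies p(z₀, z₂), so the split rules entail the same queries over
the original predicates (`entails_splitRules`). Without it, the second rule does not depend on the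
first: a piece-unifier would have to absorb both body atoms and would merge two distinct existential
variables (`not_dependsOn_fireRule_trigRule`). All dependencies thus go from second rules to first
rules, and no path has length two. -/

theorem Admissible.exists_isSubstitutionOf {V : Type} {T : Set (Term V)} {P : Partition T}
    (h : Admissible P) : ∃ σ, IsSubstitutionOf P σ := by
  obtain ⟨σ, hσ, hid⟩ := Partition.IsRepFun.exists_extend_partial' P (t := Set.range Sum.inr) (by
    rintro _ _ ⟨c, rfl⟩ ⟨d, rfl⟩ ⟨C, hC, hc, hd⟩
    rw [h C hC c d hc hd])
  refine ⟨σ, hσ, fun C hC c hc t ht => ?_⟩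
  rw [hσ.apply_eq_apply ⟨C, hC, ht, hc⟩]
  exact hid ⟨c, rfl⟩

/-- Condition (1) would be vacuous if the partition yielded no substitution; admissibility provides
one, and atoms with equal images share their predicate. This excludes every unwanted edge except
those from a trigger rule to a fire rule. -/
theorem DependsOn.exists_common_predicate {V : Type} {r₂ r₁ : Rule V} (h : DependsOn r₂ r₁) :
    ∃ a ∈ Rule.body r₂, ∃ b ∈ Rule.head r₁, a.1 = b.1 := by
  obtain ⟨Q', H', P, hP⟩ := h
  obtain ⟨σ, hσ⟩ := hP.admissible.exists_isSubstitutionOf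
  obtain ⟨a, ha⟩ := hP.nonempty
  obtain ⟨b, hb, hab⟩ : Atom.map σ a ∈ Atom.map σ '' H' := by
    rw [hP.unifies σ hσ]
    exact ⟨a, ha, rfl⟩
  have ha' := hP.subset_query ha
  have hb' := hP.subset_head hb
  simp only [bodySet, headSet, Rule.rename, Rule.body, Rule.head, Set.mem_ofPred_eq,
    List.mem_map] at ha' hb'
  obtain ⟨a₀, ha₀, rfl⟩ := ha'
  obtain ⟨b₀, hb₀, rfl⟩ := hb'
  exact ⟨a₀, ha₀, b₀, hb₀, (congrArg Prod.fst hab).symm⟩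

theorem IsPieceUnifier.eq_var_of_apply_eq {V : Type} {Q : Set (Atom V)} {r : Rule V}
    {Q' H' : Set (Atom V)} {P : Partition (termsOf (Q' ∪ H'))} (hP : IsPieceUnifier Q r Q' H' P)
    {σ : Term V → Term V} (hσ : IsSubstitutionOf P σ) {z : V} (hz : z ∈ existVars r)
    {t : Term V} (ht : t ∈ termsOf (Q' ∪ H')) (hne : t ≠ Sum.inl z) (h : σ (Sum.inl z) = σ t) :
    ∃ x ∈ varsOf Q, t = Sum.inl x ∧ x ∉ varsOf (Q \ Q') := by
  obtain ⟨C, hC, htC, hzC⟩ := (hσ.1.apply_eq_apply_iff_rel ht).1 h.symm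
  obtain ⟨x, ⟨a, ha, hxa⟩, hx⟩ := hP.existential C hC z hz hzC t htC hne
  exact ⟨x, ⟨a, hP.subset_query ha, hxa⟩, hx⟩

/-! ### Splitting a rule in two steps linked by transitivity

The predicate `1` is the transitive one.  The rule `trigRule r` announces a match of the body of `r`
with a trigger atom and a path of length two; `fireRule r` waits for the shortcut of this path. -/

def bodyTerms (r : Rule ℕ) : List (Term ℕ) := (Rule.body r).flatMap Prod.snd

/-- Odd and at least 3: distinct from the even predicates of the original rules and from the link
predicate `1`. -/
def trigName (r : Rule ℕ) : ℕ := 2 * Encodable.encode r + 3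

def linkAtom (x y : ℕ) : Atom ℕ := (1, [Sum.inl x, Sum.inl y])

/-- The shift by 3 frees the variables 0, 1, 2 for the path. Only its ends 0 and 2 are recorded; the
body terms transmit the match to `fireRule`. -/
def trigAtom (r : Rule ℕ) : Atom ℕ :=
  (trigName r, Sum.inl 0 :: Sum.inl 2 :: (bodyTerms r).map (Sum.map (· + 3) id))

def trigRule (r : Rule ℕ) : Rule ℕ :=
  (Rule.body (Rule.rename (· + 3) r), [trigAtom r, linkAtom 0 1, linkAtom 1 2])

def fireRule (r : Rule ℕ) : Rule ℕ :=
  ([trigAtom r, linkAtom 0 2], Rule.head (Rule.rename (· + 3) r))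

def linkTrans : Rule ℕ := ([linkAtom 0 1, linkAtom 1 2], [linkAtom 0 2])

def splitRules (R : List (Rule ℕ)) : List (Rule ℕ) :=
  R.map trigRule ++ R.map fireRule ++ [linkTrans]

def EvenAtom {V : Type} (a : Atom V) : Prop := Even a.1

def EvenRule (r : Rule ℕ) : Prop :=
  (∀ a ∈ Rule.body r, EvenAtom a) ∧ ∀ a ∈ Rule.head r, EvenAtom a

theorem not_even_trigName (r : Rule ℕ) : ¬ Even (trigName r) := by
  rw [trigName, Nat.not_even_iff]; omega

theorem trigName_ne_one (r : Rule ℕ) : trigName r ≠ 1 := by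
  rw [trigName]; omega

theorem trigName_injective : Function.Injective trigName := by
  intro r s h
  apply Encodable.encode_injective
  simp only [trigName] at h
  omega

theorem mem_bodyTerms {r : Rule ℕ} {t : Term ℕ} : t ∈ bodyTerms r ↔ t ∈ termsOf (bodySet r) := by
  simp [bodyTerms, termsOf, bodySet]

/-! ### Acyclicity of the split rules -/

theorem mem_existVars_rename_trigRule (r : Rule ℕ) {n : ℕ} (hn : n < 3) :
    (Sum.inr n : ℕ ⊕ ℕ) ∈ existVars (Rule.rename Sum.inr (trigRule r)) := by
  constructor
  · have : n = 0 ∨ n = 1 ∨ n = 2 := by omega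
    simp only [varsOf, termsOf, headSet, Rule.rename, Rule.head, trigRule, Set.mem_ofPred_eq,
      List.mem_map]
    rcases this with rfl | rfl | rfl
    · exact ⟨_, ⟨linkAtom 0 1, by simp, rfl⟩, by simp [Atom.map, linkAtom]⟩
    · exact ⟨_, ⟨linkAtom 0 1, by simp, rfl⟩, by simp [Atom.map, linkAtom]⟩
    · exact ⟨_, ⟨linkAtom 1 2, by simp, rfl⟩, by simp [Atom.map, linkAtom]⟩
  · rintro ⟨a, ha, hna⟩
    simp only [bodySet, Rule.rename, Rule.body, trigRule, Set.mem_ofPred_eq, List.mem_map] at ha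
    obtain ⟨_, ⟨b, -, rfl⟩, rfl⟩ := ha
    simp only [Atom.map, List.mem_map] at hna
    obtain ⟨_, ⟨t, -, rfl⟩, ht⟩ := hna
    rcases t with x | c
    · simp at ht
      omega
    · simp at ht

theorem not_dependsOn_fireRule_trigRule (s r : Rule ℕ) :
    ¬ DependsOn (fireRule s) (trigRule r) := by
  rintro ⟨Q', H', P, hP⟩
  obtain ⟨σ, hσ⟩ := hP.admissible.exists_isSubstitutionOf
  set q₁ : Atom (ℕ ⊕ ℕ) := Atom.map (Sum.map Sum.inl id) (trigAtom s) with hq₁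
  set q₂ : Atom (ℕ ⊕ ℕ) := Atom.map (Sum.map Sum.inl id) (linkAtom 0 2) with hq₂
  set h₁ : Atom (ℕ ⊕ ℕ) := Atom.map (Sum.map Sum.inr id) (trigAtom r) with hh₁
  set h₂ : Atom (ℕ ⊕ ℕ) := Atom.map (Sum.map Sum.inr id) (linkAtom 0 1) with hh₂
  set h₃ : Atom (ℕ ⊕ ℕ) := Atom.map (Sum.map Sum.inr id) (linkAtom 1 2) with hh₃
  have hQ : bodySet (Rule.rename Sum.inl (fireRule s)) = {q₁, q₂} := by
    ext a; simp [bodySet, Rule.rename, Rule.body, fireRule, q₁, q₂]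
  have hH : headSet (Rule.rename Sum.inr (trigRule r)) = {h₁, h₂, h₃} := by
    ext a; simp [headSet, Rule.rename, Rule.head, trigRule, h₁, h₂, h₃]
  have matched : ∀ a ∈ Q', ∃ b ∈ H', (b = h₁ ∨ b = h₂ ∨ b = h₃) ∧ Atom.map σ b = Atom.map σ a := by
    intro a ha
    obtain ⟨b, hb, hab⟩ : Atom.map σ a ∈ Atom.map σ '' H' := by
      rw [hP.unifies σ hσ]
      exact ⟨a, ha, rfl⟩
    have hb' := hP.subset_head hb
    rw [hH] at hb'
    exact ⟨b, hb, hb', hab⟩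
  have termsQ : ∀ a ∈ Q', ∀ t ∈ a.2, t ∈ termsOf (Q' ∪ H') := fun a ha t ht => ⟨a, .inl ha, ht⟩
  have termsH : ∀ a ∈ H', ∀ t ∈ a.2, t ∈ termsOf (Q' ∪ H') := fun a ha t ht => ⟨a, .inr ha, ht⟩
  -- the terms unified with an existential variable come from the query
  have separate : ∀ m n : ℕ, m < 3 → m ≠ n →
      (Sum.inl (Sum.inr n) : Term (ℕ ⊕ ℕ)) ∈ termsOf (Q' ∪ H') →
      σ (Sum.inl (Sum.inr m)) ≠ σ (Sum.inl (Sum.inr n)) := by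
    intro m n hm hmn hn h
    obtain ⟨x, ⟨a, ha, hxa⟩, hx, -⟩ := hP.eq_var_of_apply_eq hσ (mem_existVars_rename_trigRule r hm)
      hn (by simpa using Ne.symm hmn) h
    obtain rfl : Sum.inr n = x := by simpa using hx
    simp only [bodySet, Rule.rename, Rule.body, Set.mem_ofPred_eq, List.mem_map] at ha
    obtain ⟨b, -, rfl⟩ := ha
    simp only [Atom.map, List.mem_map] at hxa
    obtain ⟨t, -, ht⟩ := hxa
    rcases t with y | c <;> simp at ht
  -- A query variable merged with an existential one cannot occur outside `Q'`, so every body atom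
  -- containing it is drawn into `Q'`.
  have absorb : ∀ m k : ℕ, m < 3 →
      (Sum.inl (Sum.inl k) : Term (ℕ ⊕ ℕ)) ∈ termsOf (Q' ∪ H') →
      σ (Sum.inl (Sum.inr m)) = σ (Sum.inl (Sum.inl k)) →
      ∀ a, (a = q₁ ∨ a = q₂) → Sum.inl (Sum.inl k) ∈ a.2 → a ∈ Q' := by
    intro m k hm hk h a ha hka
    by_contra haQ
    obtain ⟨x, -, hx, hx'⟩ := hP.eq_var_of_apply_eq hσ (mem_existVars_rename_trigRule r hm)
      hk (by simp) h
    obtain rfl : Sum.inl k = x := by simpa using hx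
    exact hx' ⟨a, ⟨by rw [hQ]; exact ha, haQ⟩, hka⟩
  have e₁ : ∀ b, (b = h₁ ∨ b = h₂ ∨ b = h₃) → Atom.map σ b = Atom.map σ q₁ →
      σ (Sum.inl (Sum.inr 0)) = σ (Sum.inl (Sum.inl 0)) ∧
        σ (Sum.inl (Sum.inr 2)) = σ (Sum.inl (Sum.inl 2)) := by
    rintro b (rfl | rfl | rfl) hb
    · simp only [hh₁, hq₁, Atom.map, trigAtom, List.map_cons, Sum.map_inl, Prod.mk.injEq,
        List.cons.injEq] at hb
      exact ⟨hb.2.1, hb.2.2.1⟩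
    all_goals exact absurd (congrArg Prod.fst hb).symm (trigName_ne_one s)
  have mem₀₁ : Sum.inl (Sum.inl 0) ∈ q₁.2 := by simp [hq₁, Atom.map, trigAtom]
  have mem₀₂ : Sum.inl (Sum.inl 0) ∈ q₂.2 := by simp [hq₂, Atom.map, linkAtom]
  have memq₂ : q₂ ∈ Q' := by
    obtain ⟨a, ha⟩ := hP.nonempty
    have ha' := hP.subset_query ha
    rw [hQ] at ha'
    rcases ha' with rfl | rfl
    · obtain ⟨b, -, hb, hab⟩ := matched _ ha
      exact absorb 0 0 (by norm_num) (termsQ _ ha _ mem₀₁) (e₁ b hb hab).1 _ (.inr rfl) mem₀₂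
    · exact ha
  obtain ⟨b, hbH, hb, hab⟩ := matched _ memq₂
  have t₀ := termsQ _ memq₂ _ mem₀₂
  rcases hb with rfl | rfl | rfl
  · exact trigName_ne_one r (congrArg Prod.fst hab)
  -- Matching the first edge sends query variable 2 to z₁, whereas the absorbed trigger sends it to
  -- z₂.
  · simp only [hh₂, hq₂, Atom.map, linkAtom, List.map_cons, Sum.map_inl, Prod.mk.injEq,
      List.cons.injEq] at hab
    have memq₁ := absorb 0 0 (by norm_num) t₀ hab.2.1 _ (.inl rfl) mem₀₁
    obtain ⟨b', -, hb', hab'⟩ := matched _ memq₁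
    refine separate 2 1 (by norm_num) (by norm_num) (termsH _ hbH _ ?_)
      ((e₁ b' hb' hab').2.trans hab.2.2.1.symm)
    simp [hh₂, Atom.map, linkAtom]
  -- Symmetrically, the second edge sends query variable 0 to z₁ and the trigger sends it to z₀.
  · simp only [hh₃, hq₂, Atom.map, linkAtom, List.map_cons, Sum.map_inl, Prod.mk.injEq,
      List.cons.injEq] at hab
    have memq₁ := absorb 1 0 (by norm_num) t₀ hab.2.1 _ (.inl rfl) mem₀₁
    obtain ⟨b', -, hb', hab'⟩ := matched _ memq₁
    refine separate 0 1 (by norm_num) (by norm_num) (termsH _ hbH _ ?_)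
      ((e₁ b' hb' hab').1.trans hab.2.1.symm)
    simp [hh₃, Atom.map, linkAtom]

theorem isAGRD_trigRule_fireRule {R : Set (Rule ℕ)} (hR : ∀ r ∈ R, r.Proper ∧ EvenRule r) :
    IsAGRD (trigRule '' R ∪ fireRule '' R) := by
  have bodyTrig : ∀ r ∈ R, ∀ a ∈ Rule.body (trigRule r), Even a.1 := by
    intro r hr a ha
    simp only [trigRule, Rule.rename, Rule.body, List.mem_map] at ha
    obtain ⟨b, hb, rfl⟩ := ha
    exact (hR r hr).2.1 b hb
  have headFire : ∀ r ∈ R, ∀ a ∈ Rule.head (fireRule r), Even a.1 := by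
    intro r hr a ha
    simp only [fireRule, Rule.rename, Rule.head, List.mem_map] at ha
    obtain ⟨b, hb, rfl⟩ := ha
    exact (hR r hr).2.2 b hb
  have headTrig : ∀ r, ∀ a ∈ Rule.head (trigRule r), ¬ Even a.1 := by
    intro r a ha
    simp only [trigRule, Rule.head, List.mem_cons, List.not_mem_nil, or_false] at ha
    rcases ha with rfl | rfl | rfl
    · exact not_even_trigName r
    all_goals exact Nat.not_even_one
  have bodyFire : ∀ r, ∀ a ∈ Rule.body (fireRule r), ¬ Even a.1 := by
    intro r a ha
    simp only [fireRule, Rule.body, List.mem_cons, List.not_mem_nil, or_false] at ha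
    rcases ha with rfl | rfl
    · exact not_even_trigName r
    · exact Nat.not_even_one
  have edge : ∀ r s, GRD (trigRule '' R ∪ fireRule '' R) r s →
      r ∈ fireRule '' R ∧ s ∈ trigRule '' R := by
    rintro r s ⟨hr, hs, h⟩
    obtain ⟨a, ha, b, hb, hab⟩ := h.exists_common_predicate
    rcases hr with ⟨r, hr, rfl⟩ | hr
    · exfalso
      rcases hs with ⟨s, hs, rfl⟩ | ⟨s, hs, rfl⟩
      · exact headTrig r b hb (hab ▸ bodyTrig s hs a ha)
      · exact not_dependsOn_fireRule_trigRule s r h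
    · refine ⟨hr, hs.resolve_right ?_⟩
      rintro ⟨s, hs, rfl⟩
      obtain ⟨r, hr, rfl⟩ := hr
      exact bodyFire s a ha (hab ▸ headFire r hr b hb)
  intro r h
  -- A vertex on a cycle has an outgoing edge, hence is a fire rule, and an incoming one, hence is a
  -- trigger rule; its body predicates would be both odd and even.
  obtain ⟨s, hs, -⟩ := Relation.TransGen.head'_iff.1 h
  obtain ⟨t, -, ht⟩ := Relation.TransGen.tail'_iff.1 h
  obtain ⟨u, hu, hur⟩ := (edge r s hs).1
  obtain ⟨w, hw, hwr⟩ := (edge t r ht).2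
  obtain ⟨a, ha⟩ := List.exists_mem_of_ne_nil _
    (show Rule.body r ≠ [] by rw [← hur]; simp [fireRule, Rule.body])
  exact bodyFire u a (hur ▸ ha) (bodyTrig w hw a (hwr ▸ ha))

theorem isTransitivityRule_linkTrans : IsTransitivityRule linkTrans := by
  refine ⟨1, 0, 1, 2, by norm_num, by norm_num, by norm_num, ?_, ?_⟩
  · ext a; simp [bodySet, Rule.body, linkTrans, linkAtom]
  · ext a; simp [headSet, Rule.head, linkTrans, linkAtom]

theorem isAGRDSingleTrans_splitRules (F : List Fact) {R : List (Rule ℕ)}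
    (hR : ∀ r ∈ R, r.Proper ∧ EvenRule r) : IsAGRDSingleTrans (F, splitRules R) := by
  refine ⟨fun r hr => ?_, trigRule '' {r | r ∈ R} ∪ fireRule '' {r | r ∈ R}, linkTrans,
    isAGRD_trigRule_fireRule hR, isTransitivityRule_linkTrans, ?_⟩
  · simp only [KB.rules, splitRules, List.mem_append, List.mem_map, List.mem_singleton] at hr
    rcases hr with (⟨s, hs, rfl⟩ | ⟨s, hs, rfl⟩) | rfl
    · have := (hR s hs).1.1
      constructor <;> simp_all [trigRule, Rule.body, Rule.head, Rule.rename]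
    · have := (hR s hs).1.2
      constructor <;> simp_all [fireRule, Rule.body, Rule.head, Rule.rename]
    · constructor <;> simp [linkTrans, Rule.body, Rule.head]
  · ext r
    simp only [KB.ruleSet, KB.rules, splitRules, Set.mem_union, Set.mem_image, Set.mem_ofPred_eq,
      List.mem_append, List.mem_map, List.mem_singleton, Set.mem_singleton_iff]

theorem IsAGRDSingleTrans.isAGRDTrans {K : KB} (h : IsAGRDSingleTrans K) : IsAGRDTrans K := by
  obtain ⟨hp, Ra, t, hRa, ht, hK⟩ := h
  exact ⟨hp, Ra, {t}, hRa, by rintro r rfl; exact ht, hK⟩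

/-! ### Splitting preserves entailment -/

namespace Interp
variable {D : Type}

theorem satAtom_map {V W : Type} (I : Interp D) (v : W → D) (f : V → W) (a : Atom V) :
    I.SatAtom v (Atom.map (Sum.map f id) a) ↔ I.SatAtom (v ∘ f) a := by
  have : I.eval v ∘ Sum.map f id = I.eval (v ∘ f) := by
    ext t; cases t <;> rfl
  simp [SatAtom, Atom.map, this]

theorem satAtom_congr {V : Type} (I : Interp D) {v w : V → D} {a : Atom V}
    (h : ∀ x, Sum.inl x ∈ a.2 → v x = w x) : I.SatAtom v a ↔ I.SatAtom w a := by
  have : a.2.map (I.eval v) = a.2.map (I.eval w) := by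
    apply List.map_congr_left
    rintro (x | c) hx
    · exact h x hx
    · rfl
  rw [SatAtom, SatAtom, this]

theorem satRule_of_split (I : Interp D) {r : Rule ℕ} (h : I.SatRule linkTrans)
    (h₁ : I.SatRule (trigRule r)) (h₂ : I.SatRule (fireRule r)) : I.SatRule r := by
  intro v hv
  -- Subtracting 3 undoes the shift; the values at 0, 1, 2 do not matter, as these variables are
  -- absent from the body.
  obtain ⟨w, hwv, hw⟩ := h₁ (fun n => v (n - 3)) (by
    intro a ha
    simp only [trigRule, Rule.rename, Rule.body, List.mem_map] at ha
    obtain ⟨b, hb, rfl⟩ := ha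
    rw [satAtom_map]
    exact hv b hb)
  simp only [trigRule, Rule.head, List.forall_mem_cons] at hw
  obtain ⟨u, huw, hu⟩ := h w (by
    simp only [linkTrans, Rule.body, List.forall_mem_cons]
    exact hw.2)
  have link : I.SatAtom w (linkAtom 0 2) := by
    have hu := hu (linkAtom 0 2) (by simp [linkTrans, Rule.head])
    refine (I.satAtom_congr fun x hx => ?_).1 hu
    apply huw
    simp only [linkAtom, List.mem_cons, Sum.inl.injEq, List.not_mem_nil, or_false] at hx
    rcases hx with rfl | rfl
    · exact ⟨linkAtom 0 1, by simp [bodySet, Rule.body, linkTrans], by simp [linkAtom]⟩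
    · exact ⟨linkAtom 1 2, by simp [bodySet, Rule.body, linkTrans], by simp [linkAtom]⟩
  obtain ⟨s, hsw, hs⟩ := h₂ w (by
    simp only [fireRule, Rule.body, List.forall_mem_cons]
    exact ⟨hw.1, link, by simp⟩)
  refine ⟨s ∘ (· + 3), fun x hx => ?_, fun a ha => ?_⟩
  · have hs' : s (x + 3) = w (x + 3) := by
      refine hsw _ ⟨trigAtom r, by simp [bodySet, Rule.body, fireRule], ?_⟩
      simp only [trigAtom, List.mem_cons, List.mem_map]
      exact .inr (.inr ⟨Sum.inl x, mem_bodyTerms.2 hx, rfl⟩)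
    have hw' : w (x + 3) = v (x + 3 - 3) := by
      obtain ⟨a, ha, hxa⟩ := hx
      refine hwv _ ⟨Atom.map (Sum.map (· + 3) id) a, ?_, ?_⟩
      · exact List.mem_map.2 ⟨a, ha, rfl⟩
      · exact List.mem_map.2 ⟨_, hxa, rfl⟩
    simpa [hs'] using hw'
  · rw [← satAtom_map]
    exact hs _ (List.mem_map.2 ⟨a, ha, rfl⟩)

/-- The expansion of an interpretation of the even predicates where the transitive relation is full
and the trigger atoms tell the matches of the rule bodies. -/
def expand (I : Interp D) : Interp D where
  const := I.const
  rel n l := (Even n ∧ I.rel n l) ∨ n = 1 ∨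
    ∃ (r : Rule ℕ) (v : ℕ → D) (d d' : D), n = trigName r ∧
      l = d :: d' :: (bodyTerms r).map (I.eval v) ∧ ∀ a ∈ Rule.body r, I.SatAtom v a

theorem expand_rel_of_even (I : Interp D) {n : ℕ} (hn : Even n) (l : List D) :
    I.expand.rel n l ↔ I.rel n l := by
  refine ⟨?_, fun h => .inl ⟨hn, h⟩⟩
  rintro (h | rfl | ⟨r, -, -, -, rfl, -⟩)
  · exact h.2
  · exact absurd hn Nat.not_even_one
  · exact absurd hn (not_even_trigName r)

theorem expand_satAtom {V : Type} (I : Interp D) {a : Atom V} (ha : EvenAtom a) (v : V → D) :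
    I.expand.SatAtom v a ↔ I.SatAtom v a :=
  I.expand_rel_of_even ha _

theorem expand_satRule_linkTrans (I : Interp D) : I.expand.SatRule linkTrans := by
  refine fun v _ => ⟨v, fun _ _ => rfl, fun a ha => ?_⟩
  obtain rfl : a = linkAtom 0 2 := by simpa [linkTrans, Rule.head] using ha
  exact .inr (.inl rfl)

theorem expand_satRule_trigRule (I : Interp D) {r : Rule ℕ} (hr : EvenRule r) :
    I.expand.SatRule (trigRule r) := by
  refine fun v hv => ⟨v, fun _ _ => rfl, fun a ha => ?_⟩
  simp only [trigRule, Rule.head, List.mem_cons, List.not_mem_nil, or_false] at ha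
  rcases ha with rfl | rfl | rfl
  · refine .inr (.inr ⟨r, v ∘ (· + 3), v 0, v 2, rfl, ?_, fun a ha => ?_⟩)
    · simp only [trigAtom, List.map_cons, List.map_map]
      refine congrArg₂ _ rfl (congrArg₂ _ rfl (List.map_congr_left fun t _ => ?_))
      cases t <;> rfl
    · rw [← I.expand_satAtom (hr.1 a ha), ← satAtom_map]
      exact hv _ (List.mem_map.2 ⟨a, ha, rfl⟩)
  all_goals exact .inr (.inl rfl)

/-- In the expansion a trigger holds only at the terms of a genuine match of the body of the same
rule, by injectivity of `trigName`; the full link relation adds no information. -/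
theorem expand_satRule_fireRule (I : Interp D) {r : Rule ℕ} (hr : EvenRule r)
    (h : I.SatRule r) : I.expand.SatRule (fireRule r) := by
  intro v hv
  have ht : I.expand.SatAtom v (trigAtom r) := hv _ (by simp [fireRule, Rule.body])
  rcases ht with ⟨ht, -⟩ | ht | ⟨s, u, d, d', hs, hl, hu⟩
  · exact absurd ht (not_even_trigName r)
  · exact absurd ht (trigName_ne_one r)
  obtain rfl : r = s := trigName_injective hs
  simp only [trigAtom, List.map_cons, List.map_map, List.cons.injEq] at hl
  have huv : ∀ t ∈ bodyTerms r, I.expand.eval v (Sum.map (· + 3) id t) = I.eval u t :=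
    List.map_inj_left.1 hl.2.2
  obtain ⟨w, hwu, hw⟩ := h u hu
  refine ⟨fun n => if n < 3 then v n else w (n - 3), fun x hx => ?_, fun a ha => ?_⟩
  · by_cases hx3 : x < 3
    · simp [hx3]
    · simp only [hx3, if_false]
      obtain ⟨a, ha, hxa⟩ := hx
      obtain rfl | rfl : a = trigAtom r ∨ a = linkAtom 0 2 := by
        simpa [bodySet, fireRule, Rule.body] using ha
      · simp only [trigAtom, List.mem_cons, Sum.inl.injEq, List.mem_map] at hxa
        rcases hxa with rfl | rfl | ⟨t, ht, htx⟩
        · omega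
        · omega
        · rcases t with y | c
          · obtain rfl : y + 3 = x := by simpa using htx
            exact (hwu y (mem_bodyTerms.1 ht)).trans (huv _ ht).symm
          · simp at htx
      · simp [linkAtom] at hxa
        omega
  · simp only [fireRule, Rule.rename, Rule.head, List.mem_map] at ha
    obtain ⟨b, hb, rfl⟩ := ha
    rw [satAtom_map, I.expand_satAtom (hr.2 b hb)]
    refine (I.satAtom_congr fun x _ => ?_).1 (hw b hb)
    simp

end Interp

theorem entails_splitRules {F : List Fact} {R : List (Rule ℕ)} {q : Atom ℕ}
    (hF : ∀ f ∈ F, Even f.1) (hR : ∀ r ∈ R, EvenRule r) (hq : EvenAtom q) :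
    Entails (F, splitRules R) q ↔ Entails (F, R) q := by
  constructor
  · rintro h D I ⟨hIF, hIR⟩
    obtain ⟨v, hv⟩ := h D I.expand ⟨fun f hf => (I.expand_rel_of_even (hF f hf) _).2 (hIF f hf), by
      intro r hr
      simp only [KB.rules, splitRules, List.mem_append, List.mem_map, List.mem_singleton] at hr
      rcases hr with (⟨s, hs, rfl⟩ | ⟨s, hs, rfl⟩) | rfl
      · exact I.expand_satRule_trigRule (hR s hs)
      · exact I.expand_satRule_fireRule (hR s hs) (hIR s hs)
      · exact I.expand_satRule_linkTrans⟩
    exact ⟨v, (I.expand_satAtom hq v).1 hv⟩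
  · rintro h D I ⟨hIF, hIR⟩
    refine h D I ⟨hIF, fun r hr => I.satRule_of_split (hIR _ ?_) (hIR _ ?_) (hIR _ ?_)⟩
    · simp [KB.rules, splitRules]
    · simp only [KB.rules, splitRules, List.mem_append, List.mem_map]
      exact .inl (.inl ⟨r, hr, rfl⟩)
    · simp only [KB.rules, splitRules, List.mem_append, List.mem_map]
      exact .inl (.inr ⟨r, hr, rfl⟩)

end ExRules

namespace ExRules
open Nat.Partrec (Code)

/-! ### Datalog clauses -/

/-- The rule whose body and head are given by atoms without constants, written as predicates
applied to lists of variables. -/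
def clause (B : List (ℕ × List ℕ)) (h : ℕ × List ℕ) : Rule ℕ :=
  (B.map fun a => (a.1, a.2.map Sum.inl), [(h.1, h.2.map Sum.inl)])

theorem clause_evenRule {B : List (ℕ × List ℕ)} {h : ℕ × List ℕ} (hB : ∀ a ∈ B, Even a.1)
    (hh : Even h.1) : EvenRule (clause B h) := by
  constructor
  · intro a ha
    obtain ⟨b, hb, rfl⟩ := List.mem_map.1 ha
    exact hB b hb
  · intro a ha
    obtain rfl := List.mem_singleton.1 ha
    exact hh

theorem clause_proper {B : List (ℕ × List ℕ)} {h : ℕ × List ℕ} (hB : B ≠ []) :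
    (clause B h).Proper := by
  simpa [Rule.Proper, clause, Rule.body, Rule.head] using hB

theorem Interp.satAtom_vars {D : Type} (I : Interp D) (v : ℕ → D) (n : ℕ) (l : List ℕ) :
    I.SatAtom v (n, l.map Sum.inl) ↔ I.rel n (l.map v) := by
  have : I.eval v ∘ Sum.inl = v := rfl
  simp [Interp.SatAtom, this]

/-- Safety, the condition `hs`, leaves no existential variable, so the clause is a plain
implication. -/
theorem Interp.satRule_clause {D : Type} (I : Interp D) {B : List (ℕ × List ℕ)} {h : ℕ × List ℕ}
    (hs : ∀ x ∈ h.2, ∃ a ∈ B, x ∈ a.2) :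
    I.SatRule (clause B h) ↔
      ∀ v : ℕ → D, (∀ a ∈ B, I.rel a.1 (a.2.map v)) → I.rel h.1 (h.2.map v) := by
  have hbody : ∀ v, (∀ a ∈ Rule.body (clause B h), I.SatAtom v a) ↔
      ∀ a ∈ B, I.rel a.1 (a.2.map v) := by
    intro v
    simp only [clause, Rule.body, List.forall_mem_map, I.satAtom_vars]
  have hhead : ∀ v, (∀ a ∈ Rule.head (clause B h), I.SatAtom v a) ↔ I.rel h.1 (h.2.map v) := by
    intro v
    simp only [clause, Rule.head, List.forall_mem_singleton, I.satAtom_vars]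
  refine forall_congr' fun v => imp_congr (hbody v) ?_
  simp only [hhead]
  refine ⟨?_, fun h => ⟨v, fun _ _ => rfl, h⟩⟩
  rintro ⟨w, hwv, hw⟩
  have : h.2.map v = h.2.map w := by
    refine List.map_congr_left fun x hx => (hwv x ?_).symm
    obtain ⟨a, ha, hxa⟩ := hs x hx
    exact ⟨_, List.mem_map.2 ⟨a, ha, rfl⟩, List.mem_map.2 ⟨x, hxa, rfl⟩⟩
  rwa [this]

/-! ### Rules for partial recursive functions

The predicates `0`, `2`, `4`, `6`, `8` stand for zero and the graphs of the successor, of the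
addition, of the multiplication and of the pairing of natural numbers, and `codeName c` for the graph
of the partial function computed by `c`. -/

def codeName (c : Code) : ℕ := 2 * Encodable.encode c + 10

theorem even_codeName (c : Code) : Even (codeName c) :=
  ⟨Encodable.encode c + 5, by rw [codeName]; ring⟩

def succRule : Rule ℕ := ([(2, [Sum.inl 0, Sum.inl 1])], [(2, [Sum.inl 1, Sum.inl 2])])

/-- In the base clauses the successor atom only serves to bind variable 0. The last two clauses are
the cases of `Nat.pair`: x < y is expressed by y = (x + 1) + d, and y ≤ x by x = y + d. -/
def arithRules : List (Rule ℕ) :=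
  [clause [(2, [0, 1]), (0, [2])] (4, [0, 2, 0]),
   clause [(4, [0, 1, 2]), (2, [1, 3]), (2, [2, 4])] (4, [0, 3, 4]),
   clause [(2, [0, 1]), (0, [2])] (6, [0, 2, 2]),
   clause [(6, [0, 1, 2]), (2, [1, 3]), (4, [2, 0, 4])] (6, [0, 3, 4]),
   clause [(2, [0, 1]), (4, [1, 2, 3]), (6, [3, 3, 4]), (4, [4, 0, 5])] (8, [0, 3, 5]),
   clause [(4, [0, 1, 2]), (6, [2, 2, 3]), (4, [3, 2, 4]), (4, [4, 0, 5])] (8, [2, 0, 5])]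

/-- The search of `rfind'` proceeds from m to m + 1 when the tested value has a predecessor, which
replaces a negated test for zero. -/
def codeRules : Code → List (Rule ℕ)
  | .zero => [clause [(2, [0, 1]), (0, [2])] (codeName .zero, [0, 2])]
  | .succ => [clause [(2, [0, 1])] (codeName .succ, [0, 1])]
  | .left => [clause [(8, [0, 1, 2])] (codeName .left, [2, 0])]
  | .right => [clause [(8, [0, 1, 2])] (codeName .right, [2, 1])]
  | .pair f g =>
    clause [(codeName f, [0, 1]), (codeName g, [0, 2]), (8, [1, 2, 3])]
      (codeName (.pair f g), [0, 3]) :: (codeRules f ++ codeRules g)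
  | .comp f g =>
    clause [(codeName g, [0, 1]), (codeName f, [1, 2])] (codeName (.comp f g), [0, 2]) ::
      (codeRules f ++ codeRules g)
  | .prec f g =>
    clause [(0, [0]), (8, [1, 0, 2]), (codeName f, [1, 3])] (codeName (.prec f g), [2, 3]) ::
    clause [(8, [0, 1, 2]), (codeName (.prec f g), [2, 3]), (8, [1, 3, 4]), (8, [0, 4, 5]),
        (codeName g, [5, 6]), (2, [1, 7]), (8, [0, 7, 8])] (codeName (.prec f g), [8, 6]) ::
      (codeRules f ++ codeRules g)
  | .rfind' f =>
    clause [(8, [0, 1, 2]), (codeName f, [2, 3]), (0, [3])] (codeName (.rfind' f), [2, 1]) ::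
    clause [(8, [0, 1, 2]), (codeName f, [2, 3]), (2, [4, 3]), (2, [1, 5]), (8, [0, 5, 6]),
        (codeName (.rfind' f), [6, 7])] (codeName (.rfind' f), [2, 7]) :: codeRules f

def programRules (c : Code) : List (Rule ℕ) := succRule :: (arithRules ++ codeRules c)

theorem proper_evenRule_of_mem_codeRules {c : Code} {r : Rule ℕ} (hr : r ∈ codeRules c) :
    r.Proper ∧ EvenRule r := by
  have h8 : Even 8 := by decide
  induction c with
  | zero | succ | left | right =>
    obtain rfl := List.mem_singleton.1 hr
    exact ⟨clause_proper (by simp), clause_evenRule (by simp [h8]) (even_codeName _)⟩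
  | pair f g hf hg | comp f g hf hg =>
    simp only [codeRules, List.mem_cons, List.mem_append] at hr
    rcases hr with rfl | hr | hr
    · exact ⟨clause_proper (by simp), clause_evenRule (by simp [h8, even_codeName])
        (even_codeName _)⟩
    · exact hf hr
    · exact hg hr
  | prec f g hf hg =>
    simp only [codeRules, List.mem_cons, List.mem_append] at hr
    rcases hr with rfl | rfl | hr | hr
    · exact ⟨clause_proper (by simp), clause_evenRule (by simp [h8, even_codeName])
        (even_codeName _)⟩
    · exact ⟨clause_proper (by simp), clause_evenRule (by simp [h8, even_codeName])
        (even_codeName _)⟩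
    · exact hf hr
    · exact hg hr
  | rfind' f hf =>
    simp only [codeRules, List.mem_cons] at hr
    rcases hr with rfl | rfl | hr
    · exact ⟨clause_proper (by simp), clause_evenRule (by simp [h8, even_codeName])
        (even_codeName _)⟩
    · exact ⟨clause_proper (by simp), clause_evenRule (by simp [h8, even_codeName])
        (even_codeName _)⟩
    · exact hf hr

theorem proper_evenRule_of_mem_programRules {c : Code} {r : Rule ℕ} (hr : r ∈ programRules c) :
    r.Proper ∧ EvenRule r := by
  simp only [programRules, List.mem_cons, List.mem_append] at hr
  rcases hr with rfl | hr | hr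
  · refine ⟨⟨by simp [succRule, Rule.body], by simp [succRule, Rule.head]⟩, ?_, ?_⟩ <;>
      simp [succRule, Rule.body, Rule.head, EvenAtom]
  · simp only [arithRules, List.mem_cons, List.not_mem_nil, or_false] at hr
    rcases hr with rfl | rfl | rfl | rfl | rfl | rfl <;>
      exact ⟨clause_proper (by simp), clause_evenRule (by simp; try decide) (by decide)⟩
  · exact proper_evenRule_of_mem_codeRules hr

/-! ### The standard model -/

theorem mem_eval_rfind' {f : Code} {a m y : ℕ} :
    y ∈ (Code.rfind' f).eval (Nat.pair a m) ↔ ∃ n, y = n + m ∧ 0 ∈ f.eval (Nat.pair a (n + m)) ∧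
      ∀ k < n, ∃ z, z + 1 ∈ f.eval (Nat.pair a (k + m)) := by
  simp only [Code.eval, Nat.unpaired, Nat.unpair_pair, Part.map_eq_map,
    Part.mem_map_iff]
  constructor
  · rintro ⟨n, h, rfl⟩
    obtain ⟨h0, hn⟩ := Nat.mem_rfind.1 h
    obtain ⟨z, hz, hz0⟩ := (Part.mem_map_iff _).1 h0
    obtain rfl : z = 0 := by simpa using hz0
    refine ⟨n, rfl, hz, fun k hk => ?_⟩
    obtain ⟨z, hz, hz0⟩ := (Part.mem_map_iff _).1 (hn hk)
    obtain ⟨w, rfl⟩ := Nat.exists_eq_succ_of_ne_zero (by simpa using hz0 : z ≠ 0)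
    exact ⟨w, hz⟩
  · rintro ⟨n, rfl, h0, hn⟩
    refine ⟨n, Nat.mem_rfind.2 ⟨(Part.mem_map_iff _).2 ⟨0, h0, by simp⟩, fun {k} hk => ?_⟩, rfl⟩
    obtain ⟨z, hz⟩ := hn k hk
    exact (Part.mem_map_iff _).2 ⟨z + 1, hz, by simp⟩

def standardRel : ℕ → List ℕ → Prop
  | 0, [x] => x = 0
  | 2, [x, y] => y = x + 1
  | 4, [x, y, z] => z = x + y
  | 6, [x, y, z] => z = x * y
  | 8, [x, y, z] => z = Nat.pair x y
  | n + 10, [x, y] => ∃ c : Code, n = 2 * Encodable.encode c ∧ y ∈ c.eval x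
  | _, _ => False

def standardInterp : Interp ℕ where
  const := id
  rel := standardRel

theorem standardRel_codeName (c : Code) (x y : ℕ) :
    standardRel (codeName c) [x, y] ↔ y ∈ c.eval x := by
  simp [codeName, standardRel]

theorem standardInterp_satRule_succRule : standardInterp.SatRule succRule := by
  intro v _
  refine ⟨fun n => if n = 2 then v 1 + 1 else v n, fun x hx => ?_, ?_⟩
  · obtain rfl | rfl : x = 0 ∨ x = 1 := by
      simpa [varsOf, termsOf, bodySet, Rule.body, succRule] using hx
    all_goals simp
  · simp [succRule, Rule.head, Interp.SatAtom, Interp.eval, standardInterp, standardRel]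

theorem standardInterp_satRule_of_mem_arithRules {r : Rule ℕ} (hr : r ∈ arithRules) :
    standardInterp.SatRule r := by
  simp only [arithRules, List.mem_cons, List.not_mem_nil, or_false] at hr
  rcases hr with rfl | rfl | rfl | rfl | rfl | rfl <;>
    rw [Interp.satRule_clause _ (by simp)] <;> intro v hv <;>
    simp only [List.forall_mem_cons, List.map_cons, List.map_nil, standardInterp, standardRel]
      at hv ⊢
  · omega
  · omega
  · simp [hv.2.1]
  · obtain ⟨h₁, h₂, h₃, -⟩ := hv
    rw [h₃, h₂, h₁]; ring
  · obtain ⟨h₁, h₂, h₃, h₄, -⟩ := hv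
    rw [Nat.pair, if_pos (by omega)]
    omega
  · obtain ⟨h₁, h₂, h₃, h₄, -⟩ := hv
    rw [Nat.pair, if_neg (by omega)]
    omega

theorem standardInterp_satRule_of_mem_codeRules {c : Code} {r : Rule ℕ} (hr : r ∈ codeRules c) :
    standardInterp.SatRule r := by
  induction c with
  | zero | succ | left | right =>
    obtain rfl := List.mem_singleton.1 hr
    rw [Interp.satRule_clause _ (by simp)]
    intro v hv
    simp only [List.forall_mem_cons, List.map_cons, List.map_nil, standardInterp,
      standardRel_codeName] at hv ⊢
    simp only [standardRel] at hv
    simp [Code.eval, hv, pure, PFun.pure]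
  | pair f g hf hg =>
    simp only [codeRules, List.mem_cons, List.mem_append] at hr
    rcases hr with rfl | hr | hr
    · rw [Interp.satRule_clause _ (by simp)]
      intro v hv
      simp only [List.forall_mem_cons, List.map_cons, List.map_nil, standardInterp,
        standardRel_codeName] at hv ⊢
      simp only [standardRel] at hv
      obtain ⟨h₁, h₂, h₃, -⟩ := hv
      simp only [Code.eval, Seq.seq, Part.mem_bind_iff, Part.map_eq_map, Part.mem_map_iff]
      exact ⟨_, ⟨_, h₁, rfl⟩, _, h₂, h₃.symm⟩
    · exact hf hr
    · exact hg hr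
  | comp f g hf hg =>
    simp only [codeRules, List.mem_cons, List.mem_append] at hr
    rcases hr with rfl | hr | hr
    · rw [Interp.satRule_clause _ (by simp)]
      intro v hv
      simp only [List.forall_mem_cons, List.map_cons, List.map_nil, standardInterp,
        standardRel_codeName] at hv ⊢
      exact Part.mem_bind_iff.2 ⟨_, hv.1, hv.2.1⟩
    · exact hf hr
    · exact hg hr
  | prec f g hf hg =>
    simp only [codeRules, List.mem_cons, List.mem_append] at hr
    rcases hr with rfl | rfl | hr | hr
    · rw [Interp.satRule_clause _ (by simp)]
      intro v hv
      simp only [List.forall_mem_cons, List.map_cons, List.map_nil, standardInterp,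
        standardRel_codeName] at hv ⊢
      simp only [standardRel] at hv
      rw [hv.2.1, hv.1, Code.eval_prec_zero]
      exact hv.2.2.1
    · rw [Interp.satRule_clause _ (by simp)]
      intro v hv
      simp only [List.forall_mem_cons, List.map_cons, List.map_nil, standardInterp,
        standardRel_codeName] at hv ⊢
      simp only [standardRel] at hv
      obtain ⟨h₁, h₂, h₃, h₄, h₅, h₆, h₇, -⟩ := hv
      rw [h₇, h₆, Code.eval_prec_succ]
      refine Part.mem_bind_iff.2 ⟨v 3, h₁ ▸ h₂, ?_⟩
      rwa [← h₃, ← h₄]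
    · exact hf hr
    · exact hg hr
  | rfind' f hf =>
    simp only [codeRules, List.mem_cons] at hr
    rcases hr with rfl | rfl | hr
    · rw [Interp.satRule_clause _ (by simp)]
      intro v hv
      simp only [List.forall_mem_cons, List.map_cons, List.map_nil, standardInterp,
        standardRel_codeName] at hv ⊢
      simp only [standardRel] at hv
      obtain ⟨h₁, h₂, h₃, -⟩ := hv
      rw [h₁, h₃] at h₂
      rw [h₁, mem_eval_rfind']
      exact ⟨0, by simp, by simpa using h₂, by simp⟩
    · rw [Interp.satRule_clause _ (by simp)]
      intro v hv
      simp only [List.forall_mem_cons, List.map_cons, List.map_nil, standardInterp,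
        standardRel_codeName] at hv ⊢
      simp only [standardRel] at hv
      obtain ⟨h₁, h₂, h₃, h₄, h₅, h₆, -⟩ := hv
      rw [h₅, h₄, mem_eval_rfind'] at h₆
      rw [h₁, h₃] at h₂
      rw [h₁, mem_eval_rfind']
      obtain ⟨n, hn, h0, hk⟩ := h₆
      refine ⟨n + 1, by omega, by rwa [show n + 1 + v 1 = n + (v 1 + 1) by ring], ?_⟩
      rintro (_ | k) hkn
      · exact ⟨v 4, by simpa using h₂⟩
      · rw [show k + 1 + v 1 = k + (v 1 + 1) by ring]
        exact hk k (by omega)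
    · exact hf hr

/-! ### Every model of the rules contains the graphs of the partial recursive functions -/

/-- The chain follows the named constants up to n + 1, then chosen successors. It must pass through
the constants because the query mentions one; it need not be injective. -/
theorem Interp.exists_numerals {D : Type} (I : Interp D) (h : I.SatRule succRule) {n : ℕ}
    (hn : ∀ i ≤ n, I.rel 2 [I.const i, I.const (i + 1)]) :
    ∃ e : ℕ → D, (∀ i ≤ n, e i = I.const i) ∧ ∀ i, I.rel 2 [e i, e (i + 1)] := by
  have step : ∀ x y, I.rel 2 [x, y] → ∃ z, I.rel 2 [y, z] := by
    intro x y hxy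
    obtain ⟨w, hw, hw'⟩ := h (fun n => if n = 0 then x else y)
      (by simpa [succRule, Rule.body, Interp.SatAtom, Interp.eval] using hxy)
    have h1 : w 1 = y := hw 1 ⟨_, List.mem_singleton.2 rfl, by simp⟩
    refine ⟨w 2, ?_⟩
    simpa [succRule, Rule.head, Interp.SatAtom, Interp.eval, h1] using hw'
  choose! next hnext using fun y (hy : ∃ x, I.rel 2 [x, y]) => step hy.choose y hy.choose_spec
  let e : ℕ → D := Nat.rec (I.const 0) fun i d => if i ≤ n then I.const (i + 1) else next d
  have hlow : ∀ i ≤ n + 1, e i = I.const i := by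
    rintro (_ | i) hi
    · rfl
    · exact if_pos (by omega : i ≤ n)
  refine ⟨e, fun i hi => hlow i (by omega), fun i => ?_⟩
  induction i with
  | zero => rw [hlow 0 (by omega), hlow (0 + 1) (by omega)]; exact hn 0 (by omega)
  | succ i ih =>
    by_cases hi : i + 1 ≤ n
    · rw [hlow (i + 1) (by omega), hlow (i + 1 + 1) (by omega)]
      exact hn _ hi
    · rw [show e (i + 1 + 1) = next (e (i + 1)) from if_neg hi]
      exact hnext _ ⟨_, ih⟩

/-- In the interpretation `I`, the image of `e` is a copy of the natural numbers, on which the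
arithmetical predicates contain the intended relations. -/
structure Numerals {D : Type} (I : Interp D) (e : ℕ → D) : Prop where
  zero : I.rel 0 [e 0]
  succ : ∀ x, I.rel 2 [e x, e (x + 1)]
  pair : ∀ x y, I.rel 8 [e x, e y, e (Nat.pair x y)]

theorem Interp.numerals_of_arithRules {D : Type} (I : Interp D)
    (h : ∀ r ∈ arithRules, I.SatRule r) {e : ℕ → D} (h0 : I.rel 0 [e 0])
    (hs : ∀ x, I.rel 2 [e x, e (x + 1)]) : Numerals I e := by
  simp only [arithRules, List.forall_mem_cons] at h
  obtain ⟨a₀, a₁, m₀, m₁, p₀, p₁, -⟩ := h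
  rw [Interp.satRule_clause _ (by simp)] at a₀ a₁ m₀ m₁ p₀ p₁
  have add : ∀ x y, I.rel 4 [e x, e y, e (x + y)] := by
    intro x y
    induction y with
    -- Here and below, the list gives the values of the first variables of the clause and the
    -- default of `getD` that of the last one.
    | zero => simpa [h0, hs] using a₀ (fun i => [e x, e (x + 1)].getD i (e 0))
    | succ y ih =>
      simpa [ih, hs, ← add_assoc] using
        a₁ (fun i => [e x, e y, e (x + y), e (y + 1)].getD i (e (x + y + 1)))
  have mul : ∀ x y, I.rel 6 [e x, e y, e (x * y)] := by
    intro x y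
    induction y with
    | zero => simpa [h0, hs] using m₀ (fun i => [e x, e (x + 1)].getD i (e 0))
    | succ y ih =>
      simpa [ih, hs, add, mul_add] using
        m₁ (fun i => [e x, e y, e (x * y), e (y + 1)].getD i (e (x * y + x)))
  refine ⟨h0, hs, fun x y => ?_⟩
  rw [Nat.pair]
  split_ifs with hxy
  · obtain ⟨d, rfl⟩ := Nat.exists_eq_add_of_lt hxy
    have := add (x + 1) d
    rw [show x + 1 + d = x + d + 1 by ring] at this
    simpa [this, hs, add, mul] using p₀ (fun i => [e x, e (x + 1), e d, e (x + d + 1),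
      e ((x + d + 1) * (x + d + 1))].getD i (e ((x + d + 1) * (x + d + 1) + x)))
  · obtain ⟨d, rfl⟩ := Nat.exists_eq_add_of_le (not_lt.1 hxy)
    simpa [hs, add, mul] using p₁ (fun i => [e y, e d, e (y + d), e ((y + d) * (y + d)),
      e ((y + d) * (y + d) + (y + d))].getD i (e ((y + d) * (y + d) + (y + d) + y)))

theorem Numerals.rel_codeName {D : Type} {I : Interp D} {e : ℕ → D} (he : Numerals I e) {c : Code}
    (h : ∀ r ∈ codeRules c, I.SatRule r) {x y : ℕ} (hy : y ∈ c.eval x) :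
    I.rel (codeName c) [e x, e y] := by
  induction c generalizing x y with
  | zero =>
    have h := h _ (List.mem_singleton.2 rfl)
    rw [Interp.satRule_clause _ (by simp)] at h
    obtain rfl : y = 0 := by simpa [Code.eval, pure, PFun.pure] using hy
    simpa [he.zero, he.succ] using h (fun i => [e x, e (x + 1)].getD i (e 0))
  | succ =>
    have h := h _ (List.mem_singleton.2 rfl)
    rw [Interp.satRule_clause _ (by simp)] at h
    obtain rfl : y = x + 1 := by simpa [Code.eval] using hy
    simpa [he.succ] using h (fun i => [e x].getD i (e (x + 1)))
  | left =>
    have h := h _ (List.mem_singleton.2 rfl)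
    rw [Interp.satRule_clause _ (by simp)] at h
    obtain rfl : y = x.unpair.1 := by simpa [Code.eval] using hy
    have := he.pair x.unpair.1 x.unpair.2
    rw [Nat.pair_unpair] at this
    simpa [this] using h (fun i => [e x.unpair.1, e x.unpair.2].getD i (e x))
  | right =>
    have h := h _ (List.mem_singleton.2 rfl)
    rw [Interp.satRule_clause _ (by simp)] at h
    obtain rfl : y = x.unpair.2 := by simpa [Code.eval] using hy
    have := he.pair x.unpair.1 x.unpair.2
    rw [Nat.pair_unpair] at this
    simpa [this] using h (fun i => [e x.unpair.1, e x.unpair.2].getD i (e x))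
  | pair f g hf hg =>
    simp only [codeRules, List.forall_mem_cons, List.forall_mem_append] at h
    obtain ⟨h, h₁, h₂⟩ := h
    rw [Interp.satRule_clause _ (by simp)] at h
    simp only [Code.eval, Seq.seq, Part.mem_bind_iff, Part.map_eq_map, Part.mem_map_iff] at hy
    obtain ⟨_, ⟨a, ha, rfl⟩, b, hb, rfl⟩ := hy
    simpa [hf h₁ ha, hg h₂ hb, he.pair] using
      h (fun i => [e x, e a, e b].getD i (e (Nat.pair a b)))
  | comp f g hf hg =>
    simp only [codeRules, List.forall_mem_cons, List.forall_mem_append] at h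
    obtain ⟨h, h₁, h₂⟩ := h
    rw [Interp.satRule_clause _ (by simp)] at h
    obtain ⟨z, hz, hy⟩ := Part.mem_bind_iff.1 hy
    simpa [hf h₁ hy, hg h₂ hz] using h (fun i => [e x, e z].getD i (e y))
  | prec f g hf hg =>
    simp only [codeRules, List.forall_mem_cons, List.forall_mem_append] at h
    obtain ⟨h, h', h₁, h₂⟩ := h
    rw [Interp.satRule_clause _ (by simp)] at h h'
    obtain ⟨⟨a, n⟩, rfl⟩ : ∃ p : ℕ × ℕ, x = Nat.pair p.1 p.2 := ⟨x.unpair, (Nat.pair_unpair x).symm⟩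
    induction n generalizing y with
    | zero =>
      rw [Code.eval_prec_zero] at hy
      simpa [he.zero, he.pair, hf h₁ hy] using
        h (fun i => [e 0, e a, e (Nat.pair a 0)].getD i (e y))
    | succ n ih =>
      rw [Code.eval_prec_succ] at hy
      obtain ⟨i, hi, hy⟩ := Part.mem_bind_iff.1 hy
      simpa [he.succ, he.pair, ih hi, hg h₂ hy] using
        h' (fun j => [e a, e n, e (Nat.pair a n), e i, e (Nat.pair n i),
          e (Nat.pair a (Nat.pair n i)), e y, e (n + 1)].getD j (e (Nat.pair a (n + 1))))
  | rfind' f hf =>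
    simp only [codeRules, List.forall_mem_cons] at h
    obtain ⟨h, h', h₁⟩ := h
    rw [Interp.satRule_clause _ (by simp)] at h h'
    obtain ⟨⟨a, m⟩, rfl⟩ : ∃ p : ℕ × ℕ, x = Nat.pair p.1 p.2 := ⟨x.unpair, (Nat.pair_unpair x).symm⟩
    obtain ⟨n, rfl, h0, hn⟩ := mem_eval_rfind'.1 hy
    clear hy
    -- Induction on the number of failed tests; the starting point varies, since the recursive
    -- clause passes to m + 1.
    induction n generalizing m with
    | zero =>
      simp only [Nat.zero_add] at h0 ⊢
      simpa [he.zero, he.pair, hf h₁ h0] using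
        h (fun i => [e a, e m, e (Nat.pair a m)].getD i (e 0))
    | succ n ih =>
      obtain ⟨z, hz⟩ := hn 0 (by omega)
      have key := ih (m + 1) (by rwa [show n + (m + 1) = n + 1 + m by ring]) fun k hk => by
        rw [show k + (m + 1) = k + 1 + m by ring]
        exact hn _ (by omega)
      rw [show n + (m + 1) = n + 1 + m by ring] at key
      rw [Nat.zero_add] at hz
      simpa [he.succ, he.pair, hf h₁ hz, key] using
        h' (fun j => [e a, e m, e (Nat.pair a m), e (z + 1), e z, e (m + 1),
          e (Nat.pair a (m + 1))].getD j (e (n + 1 + m)))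

/-! ### The reduction from the halting problem -/

/-- The chain goes one step beyond n, so that even for n = 0 there is a successor fact from which
`succRule` can start. -/
def numeralFacts (n : ℕ) : List Fact :=
  (0, [0]) :: (List.range (n + 1)).map fun i => (2, [i, i + 1])

def haltQuery (c : Code) (n : ℕ) : Atom ℕ := (codeName c, [Sum.inr n, Sum.inl 0])

theorem entails_programRules_iff (c : Code) (n : ℕ) :
    Entails (numeralFacts n, programRules c) (haltQuery c n) ↔ (c.eval n).Dom := by
  rw [Part.dom_iff_mem]
  constructor
  · intro h
    suffices hM : standardInterp.IsModel (numeralFacts n, programRules c) by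
      obtain ⟨v, hv⟩ := h ℕ standardInterp hM
      exact ⟨v 0, (standardRel_codeName c n (v 0)).1 hv⟩
    constructor
    · intro f hf
      simp only [numeralFacts, KB.facts, List.mem_cons, List.mem_map] at hf
      rcases hf with rfl | ⟨i, -, rfl⟩ <;> simp [Interp.SatFact, standardInterp, standardRel]
    · intro r hr
      simp only [programRules, KB.rules, List.mem_cons, List.mem_append] at hr
      rcases hr with rfl | hr | hr
      · exact standardInterp_satRule_succRule
      · exact standardInterp_satRule_of_mem_arithRules hr
      · exact standardInterp_satRule_of_mem_codeRules hr
  · rintro ⟨y, hy⟩ D I ⟨hF, hR⟩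
    simp only [KB.facts, KB.rules, numeralFacts, programRules, List.forall_mem_cons,
      List.forall_mem_append, List.forall_mem_map, List.mem_range] at hF hR
    obtain ⟨e, hec, hes⟩ := I.exists_numerals (n := n) hR.1 fun i hi => hF.2 i (by omega)
    have he := I.numerals_of_arithRules hR.2.1 (by rw [hec 0 (by omega)]; exact hF.1) hes
    refine ⟨fun _ => e y, ?_⟩
    have := he.rel_codeName hR.2.2 hy
    rw [hec n le_rfl] at this
    exact this

/-! ### A universal program and computability of the reduction -/

theorem exists_universal_code :
    ∃ u : Code, ∀ c : Code, (u.eval (Encodable.encode c)).Dom ↔ (c.eval 0).Dom := by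
  have h : Partrec fun c : Code => c.eval 0 :=
    Code.eval_part.comp Computable.id (Computable.const 0)
  obtain ⟨u, hu⟩ := Code.exists_code.1 h
  refine ⟨u, fun c => ?_⟩
  rw [hu]
  simp

theorem primrec_numeralFacts : Primrec numeralFacts := by
  refine Primrec.list_cons.comp (Primrec.const _)
    (Primrec.list_map (Primrec.list_range.comp Primrec.succ) ?_)
  exact (Primrec.const 2).pair (Primrec.list_cons.comp Primrec.snd
    (Primrec.list_cons.comp (Primrec.succ.comp Primrec.snd) (Primrec.const [])))

theorem primrec_haltQuery (c : Code) : Primrec (haltQuery c) :=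
  (Primrec.const _).pair (Primrec.list_cons.comp Primrec.sumInr (Primrec.const _))

theorem DecidableOn.computablePred {α β : Type} [Primcodable α] [Primcodable β] {C P : α → Prop}
    (h : DecidableOn C P) {g : β → α} (hg : Computable g) (hC : ∀ b, C (g b)) :
    ComputablePred fun b => P (g b) := by
  classical
  obtain ⟨f, hf, hfC⟩ := h
  refine ⟨fun _ => Classical.dec _, (hf.comp hg).of_eq fun b => ?_⟩
  obtain ⟨t, ht, htP⟩ := hfC (g b) (hC b)
  rw [Part.eq_some_iff.2 ht]
  congr 1
  rw [Bool.eq_iff_iff, htP, decide_eq_true_iff]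

/-- With a universal code the rules are fixed and only the facts and the query vary, so the
splitting need not be shown computable. The arbitrary class `C` covers both claims of the theorem.
-/
theorem not_decidableOn_of_isAGRDSingleTrans_imp {C : KB → Prop}
    (hC : ∀ K, IsAGRDSingleTrans K → C K) :
    ¬ DecidableOn (fun i : KB × Atom ℕ => C i.1) (fun i => Entails i.1 i.2) := by
  intro h
  obtain ⟨u, hu⟩ := exists_universal_code
  have hR : ∀ r ∈ programRules u, r.Proper ∧ EvenRule r :=
    fun r hr => proper_evenRule_of_mem_programRules hr
  let g : Code → KB × Atom ℕ := fun c =>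
    ((numeralFacts (Encodable.encode c), splitRules (programRules u)),
      haltQuery u (Encodable.encode c))
  have hg : Primrec g :=
    ((primrec_numeralFacts.comp Primrec.encode).pair (Primrec.const _)).pair
      ((primrec_haltQuery u).comp Primrec.encode)
  have hP := h.computablePred hg.to_comp fun c => hC _ (isAGRDSingleTrans_splitRules _ hR)
  refine ComputablePred.halting_problem 0 (hP.of_eq fun c => ?_)
  refine (entails_splitRules ?_ (fun r hr => (hR r hr).2) (q := haltQuery u _)
    (even_codeName u)).trans
    ((entails_programRules_iff u _).trans (hu c))
  intro f hf
  simp only [numeralFacts, List.mem_cons, List.mem_map] at hf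
  rcases hf with rfl | ⟨i, -, rfl⟩ <;> simp

end ExRules
theorem theorem1 :
    (¬ ExRules.DecidableOn (fun i : ExRules.KB × ExRules.Atom ℕ => ExRules.IsAGRDTrans i.1)
        (fun i => ExRules.Entails i.1 i.2)) ∧
    (¬ ExRules.DecidableOn (fun i : ExRules.KB × ExRules.Atom ℕ => ExRules.IsAGRDSingleTrans i.1)
        (fun i => ExRules.Entails i.1 i.2)) :=
  ⟨ExRules.not_decidableOn_of_isAGRDSingleTrans_imp fun _ h => h.isAGRDTrans,
    ExRules.not_decidableOn_of_isAGRDSingleTrans_imp fun _ h => h⟩
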